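/- \textbf{Conventions.} All Banach spaces are real. For a finite $s\subset\mathbb N$ write $s=\{s(1)<\dots<s(|s|)\}$, and for a family $\mathcal F$ of finite subsets of $\mathbb N$ and $n\in\mathbb N$ let $\mathcal F_{\{n\}}=\{s: n<\min s,\ \{n\}\cup s\in\mathcal F\}$ (where $n<\min\emptyset$ by convention). For $M\subseteq\mathbb N$ let $M/n=\{m\in M: m>n\}$. $\mathcal F$ is \emph{$\alpha$-uniform on} an infinite set $M\subseteq\mathbb N$ if: $\alpha=0$ and $\mathcal F=\{\emptyset\}$; or $\alpha=\beta+1$ and $\mathcal F_{\{n\}}$ is $\beta$-uniform on $M/n$ for each $n\in M$; or $\alpha$ is a limit ordinal and there are ordinals $\alpha_n<\alpha$ $(n\in M)$, nondecreasing in $n$ with supremum $\alpha$, such that $\mathcal F_{\{n\}}$ is $\alpha_n$-uniform on $M/n$ for each $n\in M$. A \emph{$\xi$-uniform barrier} is a family $\mathcal B$ of finite subsets of $\mathbb N$ that is $\xi$-uniform on $\mathbb N$, such that every infinite $M\subseteq\mathbb N$ has an initial segment in $\mathcal B$ and no two distinct members of $\mathcal B$ are comparable under inclusion. A finite sequence $(s_i)_{i=1}^n$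 of finite subsets of $\mathbb N$ is \emph{plegma} if $|s_1|\le\dots\le|s_n|$; $s_i(k)<s_j(k)$ whenever $i<j$ and $k\le\min\{|s_i|,|s_j|\}$; and $s_i(k)<s_j(k+1)$ for all $i,j$ whenever $k\le|s_i|$ and $k+1\le|s_j|$. Let $X$ be a Banach space and $\xi<\omega_1$. $AM_\xi(X)$ is the class of all Banach spaces $E$ with a normalized Schauder basis $(e_i)_{i\ge1}$ for which there are a $\xi$-uniform barrier $\mathcal B$, norm-one vectors $x^i_s\in X$ $(i\ge 1,\ s\in\mathcal B)$, and a sequence $\varepsilon_m\searrow0$ such that $$\Big|\,\Big\|\sum_{i=1}^n a_ie_i\Big\|_E-\Big\|\sum_{i=1}^n a_ix^i_{s_i}\Big\|_X\Big|<\varepsilon_m$$ for all $n<m$, all plegma $(s_i)_{i=1}^n$ in $\mathcal B$ with $\min s_i>m$ for every $i$, and all $(a_i)_{i=1}^n\in[-1,1]^n$. $SP_\xi(X)$ is the class of those $(E,(e_i))$ for which this holds with some $x^i_s$ that do not depend on $i$. A Banach space $E$ with a Schauder basis $(e_i)_{i\ge1}$ is a \emph{spreading model} generated by a normalized basic sequence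 $(x_i)$ if there is $\varepsilon_m\searrow0$ such that $$\Big|\,\Big\|\sum_{j=1}^n a_jx_{s(j)}\Big\|-\Big\|\sum_{j=1}^n a_je_j\Big\|_E\Big|<\varepsilon_{s(1)}$$ for all nonempty finite $s\subset\mathbb N$ with $n=|s|\le s(1)$ and all $(a_j)_{j=1}^n\in[-1,1]^n$. \textbf{Theorem.} Let $X$ be a Banach space and let $\xi$ be an ordinal with $0<\xi<\omega_1$. \begin{enumerate} \item $SP_\xi(X)\subseteq AM_\xi(X)$. \item If $(f_i)\in AM_\xi(X)$ and some subsequence of $(f_i)$ generates $(e_i)$ as a spreading model, then $(e_i)\in SP_{\xi+1}(X)$. \end{enumerate} -/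

import Mathlib

namespace PlegmaModels

open Filter Topology

/-! ### Uniform barriers -/

/-- `s ⊑ A`: the finite set `s` is an initial segment of `A`. -/
def IsInitialSegment (s : Finset ℕ) (A : Set ℕ) : Prop :=
  (s : Set ℕ) ⊆ A ∧ ∀ a ∈ A, ∀ b ∈ s, a ≤ b → a ∈ s

/-- A barrier on `ℕ`: every infinite set of natural numbers has an initial segment in `B`, and
distinct members of `B` are incomparable under inclusion. -/
structure IsBarrier (B : Set (Finset ℕ)) : Prop where
  exists_initialSegment : ∀ M : Set ℕ, M.Infinite → ∃ s ∈ B, IsInitialSegment s M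
  not_subset : ∀ s ∈ B, ∀ t ∈ B, s ≠ t → ¬ s ⊆ t

/-- `𝓕_{n} = {s : n < s and {n} ∪ s ∈ 𝓕}`. -/
def derivedFamily (𝓕 : Set (Finset ℕ)) (n : ℕ) : Set (Finset ℕ) :=
  {s | (∀ k ∈ s, n < k) ∧ insert n s ∈ 𝓕}

/-- `A / n = {m ∈ A : n < m}`. -/
def tail (A : Set ℕ) (n : ℕ) : Set ℕ := {m ∈ A | n < m}

/-- `IsUniformOn α M 𝓕`: the family `𝓕` is `α`-uniform on the set `M`. As `𝓕_{n}` only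
contains sets of numbers greater than `n`, its uniformity is required on `M / n`. -/
inductive IsUniformOn : Ordinal.{0} → Set ℕ → Set (Finset ℕ) → Prop
  | zero (M : Set ℕ) : IsUniformOn 0 M {∅}
  | succ (β : Ordinal.{0}) (M : Set ℕ) (𝓕 : Set (Finset ℕ))
      (h : ∀ n ∈ M, IsUniformOn β (tail M n) (derivedFamily 𝓕 n)) :
      IsUniformOn (β + 1) M 𝓕
  | limit (α : Ordinal.{0}) (M : Set ℕ) (𝓕 : Set (Finset ℕ)) (a : ℕ → Ordinal.{0})
      (hα : Order.IsSuccLimit α) (hmono : MonotoneOn a M)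
      (hlt : ∀ n ∈ M, a n < α) (hsup : ∀ β < α, ∃ n ∈ M, β < a n)
      (h : ∀ n ∈ M, IsUniformOn (a n) (tail M n) (derivedFamily 𝓕 n)) :
      IsUniformOn α M 𝓕

/-- `B` is a `ξ`-uniform barrier (on `ℕ`). -/
def IsUniformBarrier (ξ : Ordinal.{0}) (B : Set (Finset ℕ)) : Prop :=
  IsBarrier B ∧ IsUniformOn ξ Set.univ B

/-! ### Plegma families -/

/-- The `k`-th element, counted from `0`, of `s` in increasing order. -/
def nthElt (s : Finset ℕ) (k : ℕ) (hk : k < s.card) : ℕ := s.orderEmbOfFin rfl ⟨k, hk⟩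

/-- A plegma sequence `(s_i)` of finite sets: the cardinalities do not decrease, the `k`-th
elements of the sets that have one are strictly increasing in `i`, and all of them lie below every
`(k+1)`-st element. -/
structure IsPlegma {n : ℕ} (s : Fin n → Finset ℕ) : Prop where
  card_le : ∀ i j, i ≤ j → (s i).card ≤ (s j).card
  lt_same : ∀ i j, i < j → ∀ (k : ℕ) (hi : k < (s i).card) (hj : k < (s j).card),
    nthElt (s i) k hi < nthElt (s j) k hj
  lt_next : ∀ i j, ∀ (k : ℕ) (hi : k < (s i).card) (hj : k + 1 < (s j).card),
    nthElt (s i) k hi < nthElt (s j) (k + 1) hj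

/-! ### Bases -/

section Bases

variable {E : Type*} [NormedAddCommGroup E] [NormedSpace ℝ E]

/-- The sequence `e` is a Schauder basis of `E`. -/
def IsSchauderBasis (e : ℕ → E) : Prop :=
  ∃ b : SchauderBasis ℝ E, ∀ n, b n = e n

/-- The sequence `x` is a Schauder basis of its closed linear span. -/
def IsBasicSequence (x : ℕ → E) : Prop :=
  ∃ b : SchauderBasis ℝ (Submodule.span ℝ (Set.range x)).topologicalClosure,
    ∀ n, (b n : E) = x n

end Bases

/-! ### Spreading models and asymptotic models -/

section Models

variable {X : Type*} [NormedAddCommGroup X] [NormedSpace ℝ X]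
variable {E : Type*} [NormedAddCommGroup E] [NormedSpace ℝ E]

/-- The normalized basic sequence `x` generates `e`, a Schauder basis of `E`, as a (classical)
spreading model. -/
def GeneratesSpreadingModel (x : ℕ → X) (e : ℕ → E) : Prop :=
  (∀ n, ‖x n‖ = 1) ∧ IsBasicSequence x ∧ IsSchauderBasis e ∧
  ∃ ε : ℕ → ℝ, Antitone ε ∧ Tendsto ε atTop (𝓝 0) ∧
    ∀ (n : ℕ) (s : Fin (n + 1) → ℕ), StrictMono s → n + 1 ≤ s 0 →
      ∀ a : Fin (n + 1) → ℝ, (∀ j, |a j| ≤ 1) →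
        |‖∑ j, a j • x (s j)‖ - ‖∑ j, a j • e j‖| < ε (s 0)

/-- The matrix `(x i s)`, `i ∈ ℕ`, `s ∈ B`, generates `e`, a normalized Schauder basis of `E`, as
an asymptotic model. -/
def GeneratesAsymptoticModel (B : Set (Finset ℕ)) (x : ℕ → B → X) (e : ℕ → E) : Prop :=
  (∀ n, ‖e n‖ = 1) ∧ IsSchauderBasis e ∧
  ∃ ε : ℕ → ℝ, Antitone ε ∧ Tendsto ε atTop (𝓝 0) ∧
    ∀ n m : ℕ, n < m → ∀ s : Fin n → B, IsPlegma (fun i => (s i : Finset ℕ)) →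
      (∀ i, ∀ k ∈ (s i : Finset ℕ), m < k) →
      ∀ a : Fin n → ℝ, (∀ i, |a i| ≤ 1) →
        |‖∑ i, a i • e i‖ - ‖∑ i, a i • x i (s i)‖| < ε m

variable (X)

/-- `(E, e) ∈ AM_ξ(X)`: `e` is generated as an asymptotic model by a `B × ℕ`-matrix in the unit
sphere of `X`, for some `ξ`-uniform barrier `B`. -/
def MemAM (ξ : Ordinal.{0}) (e : ℕ → E) : Prop :=
  ∃ (B : Set (Finset ℕ)) (x : ℕ → B → X), IsUniformBarrier ξ B ∧ (∀ i s, ‖x i s‖ = 1) ∧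
    GeneratesAsymptoticModel B x e

/-- `(E, e) ∈ SP_ξ(X)`: `e` is generated as an asymptotic model by a `B × ℕ`-matrix in the unit
sphere of `X` whose entries do not depend on the index in `ℕ`, for some `ξ`-uniform
barrier `B`. -/
def MemSP (ξ : Ordinal.{0}) (e : ℕ → E) : Prop :=
  ∃ (B : Set (Finset ℕ)) (x : ℕ → B → X), IsUniformBarrier ξ B ∧ (∀ i s, ‖x i s‖ = 1) ∧
    (∀ i j s, x i s = x j s) ∧ GeneratesAsymptoticModel B x e

end Models

end PlegmaModels

namespace PlegmaModels

open Filter Topology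

/-! ### Uniform families -/

/-! The inclusion of `MemSP` in `MemAM` is immediate. For the spreading model, let `B` and x^i_s
generate (f_i), and let (f_{φ(i)}) generate (e_i). The first element of a set can encode the
superscript: on the (ξ+1)-uniform barrier of the sets {n} ∪ s with n < s and νΛ(s) ∈ B, put
y_{{n}∪s} = x^{φ(n)}_{νΛ(s)}. For a plegma family ({n_i} ∪ s_i), the norm of Σ a_i y_{{n_i}∪s_i}
should be close to that of Σ a_i f_{φ(n_i)}, hence to that of Σ a_i e_i.

The asymptotic model only controls plegma families whose i-th set carries superscript i. So the sets
νΛ(s_i) are placed at positions φ(n_i) of a longer plegma family in `B`, whose other members get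
coefficient zero (`exists_plegma_completion`). Two choices make room for these members. The gaps of
Λ dominate φ, so the missing rows can be interpolated (`exists_interpolation`). The map ν enumerates
an infinite set on which interlaced sequences have members of `B` of nondecreasing length as initial
segments (`exists_regularPair`); this gives the cardinality clause of plegma. -/

theorem tail_infinite {A : Set ℕ} (hA : A.Infinite) (n : ℕ) : (tail A n).Infinite := by
  refine (hA.sdiff (Set.finite_Iic n)).mono ?_
  rintro m ⟨hm, hn⟩
  exact ⟨hm, not_le.1 hn⟩

theorem IsUniformOn.nonempty {α : Ordinal.{0}} {M : Set ℕ} {F : Set (Finset ℕ)}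
    (h : IsUniformOn α M F) (hM : M.Infinite) : F.Nonempty := by
  induction h with
  | zero M => exact ⟨∅, rfl⟩
  | succ β M F h ih =>
    obtain ⟨n, hn⟩ := hM.nonempty
    obtain ⟨s, hs⟩ := ih n hn (tail_infinite hM n)
    exact ⟨_, hs.2⟩
  | limit α M F a _ _ _ _ h ih =>
    obtain ⟨n, hn⟩ := hM.nonempty
    obtain ⟨s, hs⟩ := ih n hn (tail_infinite hM n)
    exact ⟨_, hs.2⟩

theorem IsUniformOn.eq_of_zero {M : Set ℕ} {F : Set (Finset ℕ)}
    (h : IsUniformOn 0 M F) : F = {∅} := by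
  generalize h0 : (0 : Ordinal.{0}) = α at h
  cases h with
  | zero => rfl
  | succ β _ _ h => exact absurd h0.symm (by simp)
  | limit _ _ _ a hα => exact absurd h0.symm hα.ne_bot

/-- The ranks of the derived families of a uniform family of nonzero rank are smaller, and
eventually exceed every smaller ordinal. -/
theorem IsUniformOn.exists_rank {α : Ordinal.{0}} {M : Set ℕ} {F : Set (Finset ℕ)}
    (h : IsUniformOn α M F) (hα : α ≠ 0) :
    ∃ a : ℕ → Ordinal.{0}, (∀ n ∈ M, IsUniformOn (a n) (tail M n) (derivedFamily F n)) ∧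
      (∀ n ∈ M, a n < α) ∧ ∀ δ < α, ∃ n, ∀ m ∈ M, n ≤ m → δ ≤ a m := by
  cases h with
  | zero => exact absurd rfl hα
  | succ β _ _ h =>
    refine ⟨fun _ => β, h, fun n _ => by simp, fun δ hδ => ⟨0, fun m _ _ => ?_⟩⟩
    simpa using hδ
  | limit _ _ _ a hα hmono hlt hsup h =>
    refine ⟨a, h, hlt, fun δ hδ => ?_⟩
    obtain ⟨n, hn, hδn⟩ := hsup δ hδ
    exact ⟨n, fun m hm hnm => hδn.le.trans (hmono hn hm hnm)⟩

/-- The pullback of a uniform family under a strictly monotone map is uniform. -/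
theorem IsUniformOn.pullback {α : Ordinal.{0}} {M : Set ℕ} {F : Set (Finset ℕ)}
    (h : IsUniformOn α M F) {ψ : ℕ → ℕ} (hψ : StrictMono ψ) (N : Set ℕ) (hN : N.Infinite)
    (hNM : ∀ n ∈ N, ψ n ∈ M) :
    IsUniformOn α N {s : Finset ℕ | (s : Set ℕ) ⊆ N ∧ s.image ψ ∈ F} := by
  have key : ∀ (F : Set (Finset ℕ)) (N : Set ℕ), ∀ n ∈ N,
      derivedFamily {s : Finset ℕ | (s : Set ℕ) ⊆ N ∧ s.image ψ ∈ F} n =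
        {s : Finset ℕ | (s : Set ℕ) ⊆ tail N n ∧ s.image ψ ∈ derivedFamily F (ψ n)} := by
    intro F N n hn
    ext s
    simp only [derivedFamily, Set.mem_ofPred_eq, Finset.coe_insert, Set.insert_subset_iff,
      Finset.image_insert, Finset.forall_mem_image, hψ.lt_iff_lt]
    constructor
    · rintro ⟨h1, ⟨-, h2⟩, h3⟩
      exact ⟨fun k hk => ⟨h2 hk, h1 k hk⟩, fun k hk => h1 k hk, h3⟩
    · rintro ⟨h1, h2, h3⟩
      exact ⟨fun k hk => (h1 hk).2, ⟨hn, fun k hk => (h1 hk).1⟩, h3⟩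
  induction h generalizing N with
  | zero M =>
    convert IsUniformOn.zero N using 1
    ext s
    simp only [Set.mem_ofPred_eq, Set.mem_singleton_iff, Finset.image_eq_empty]
    constructor
    · exact fun h => h.2
    · rintro rfl
      simp
  | succ β M F h ih =>
    refine .succ β N _ fun n hn => ?_
    rw [key F N n hn]
    exact ih (ψ n) (hNM n hn) _ (tail_infinite hN n)
      fun m hm => ⟨hNM m hm.1, hψ hm.2⟩
  | limit α M F a hα hmono hlt hsup h ih =>
    refine .limit α N _ (fun n => a (ψ n)) hα ?_ (fun n hn => hlt _ (hNM n hn)) ?_ fun n hn => ?_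
    · exact fun n hn m hm hnm => hmono (hNM n hn) (hNM m hm) (hψ.monotone hnm)
    · intro β hβ
      obtain ⟨n, hn, hβn⟩ := hsup β hβ
      obtain ⟨m, hm, hnm⟩ := hN.exists_gt n
      exact ⟨m, hm, hβn.trans_le (hmono hn (hNM m hm) (hnm.le.trans (hψ.id_le m)))⟩
    · rw [key F N n hn]
      exact ih (ψ n) (hNM n hn) _ (tail_infinite hN n)
        fun m hm => ⟨hNM m hm.1, hψ hm.2⟩

/-! ### Interlaced sequences -/

/-- `S 0 < T 0 < S 1 < T 1 < ⋯`. -/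
def Interlaced (S T : ℕ → ℕ) : Prop := ∀ k, S k < T k ∧ T k < S (k + 1)

/-- Whenever `S` and `T` are interlaced sequences in `L`, initial segments of `S` in `F` are not
longer than initial segments of `T` in `G`. -/
def RegularPair (F G : Set (Finset ℕ)) (L : Set ℕ) : Prop :=
  ∀ S T : ℕ → ℕ, Interlaced S T → (∀ k, S k ∈ L) → (∀ k, T k ∈ L) → ∀ p q : ℕ,
    (Finset.range p).image S ∈ F → (Finset.range q).image T ∈ G → p ≤ q

theorem RegularPair.mono {F G : Set (Finset ℕ)} {L L' : Set ℕ} (h : RegularPair F G L)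
    (hL : L' ⊆ L) : RegularPair F G L' :=
  fun S T hST hS hT => h S T hST (fun k => hL (hS k)) fun k => hL (hT k)

theorem Interlaced.strictMono_left {S T : ℕ → ℕ} (h : Interlaced S T) : StrictMono S :=
  strictMono_nat_of_lt_succ fun k => (h k).1.trans (h k).2

theorem Interlaced.strictMono_right {S T : ℕ → ℕ} (h : Interlaced S T) : StrictMono T :=
  strictMono_nat_of_lt_succ fun k => (h k).2.trans (h (k + 1)).1

theorem image_range_succ_mem_derivedFamily {S : ℕ → ℕ} (hS : StrictMono S) {p : ℕ}
    {F : Set (Finset ℕ)} (h : (Finset.range (p + 1)).image S ∈ F) :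
    (Finset.range p).image (fun k => S (k + 1)) ∈ derivedFamily F (S 0) := by
  refine ⟨by simpa using fun k _ => hS (Nat.succ_pos k), ?_⟩
  convert h using 1
  ext x
  simp only [Finset.mem_insert, Finset.mem_image, Finset.mem_range]
  constructor
  · rintro (rfl | ⟨k, hk, rfl⟩)
    · exact ⟨0, by omega, rfl⟩
    · exact ⟨k + 1, by omega, rfl⟩
  · rintro ⟨k, hk, rfl⟩
    rcases k with _ | k
    · exact Or.inl rfl
    · exact Or.inr ⟨k, by omega, rfl⟩

/-- Diagonalization of a hereditary property of triples `(n, m, R)`. -/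
theorem exists_diagonal {M : Set ℕ} (hM : M.Infinite) (thr : ℕ → ℕ)
    (Good : ℕ → ℕ → Set ℕ → Prop)
    (hmono : ∀ n m R R', R' ⊆ R → Good n m R → Good n m R')
    (hgood : ∀ n ∈ M, ∀ m ∈ M, n < m → thr n ≤ m → ∀ R ⊆ M, R.Infinite →
      ∃ R' ⊆ R, R'.Infinite ∧ Good n m R') :
    ∃ L ⊆ M, L.Infinite ∧ ∀ n ∈ L, ∀ m ∈ L, n < m → Good n m (tail L m) := by
  -- Only finitely many n lie below m, so the reservoir is shrunk once for each of them.
  have all : ∀ m ∈ M, ∀ R ⊆ M, R.Infinite → ∃ R' ⊆ R, R'.Infinite ∧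
      ∀ n ∈ M, n < m → thr n ≤ m → Good n m R' := by
    intro m hm R hRM hR
    have : ∀ j ≤ m, ∃ R' ⊆ R, R'.Infinite ∧
        ∀ n ∈ M, n < j → thr n ≤ m → Good n m R' := by
      intro j
      induction j with
      | zero => exact fun _ => ⟨R, subset_rfl, hR, fun n _ h => absurd h (Nat.not_lt_zero n)⟩
      | succ j ih =>
        intro hj
        obtain ⟨R₁, h1, h2, h3⟩ := ih (by omega)
        by_cases hjM : j ∈ M ∧ thr j ≤ m
        · obtain ⟨R₂, h4, h5, h6⟩ := hgood j hjM.1 m hm (by omega) hjM.2 R₁ (h1.trans hRM) h2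
          refine ⟨R₂, h4.trans h1, h5, fun n hn hnj hnm => ?_⟩
          rcases Nat.lt_succ_iff_lt_or_eq.1 hnj with h | rfl
          · exact hmono _ _ _ _ h4 (h3 n hn h hnm)
          · exact h6
        · refine ⟨R₁, h1, h2, fun n hn hnj hnm => ?_⟩
          rcases Nat.lt_succ_iff_lt_or_eq.1 hnj with h | rfl
          · exact h3 n hn h hnm
          · exact absurd ⟨hn, hnm⟩ hjM
    exact this m le_rfl
  let P : ℕ × Set ℕ → Prop := fun x => x.1 ∈ M ∧ x.2 ⊆ M ∧ x.2.Infinite ∧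
    ∀ n ∈ M, n < x.1 → thr n ≤ x.1 → Good n x.1 x.2
  have step : ∀ x : {x // P x}, ∃ y : {x // P x}, x.1.1 < y.1.1 ∧ thr x.1.1 ≤ y.1.1 ∧
      y.1.1 ∈ x.1.2 ∧ y.1.2 ⊆ x.1.2 := by
    rintro ⟨⟨l, R⟩, hl, hRM, hR, -⟩
    -- Passing `thr l` here makes the threshold condition hold for l and every later element.
    obtain ⟨m, hm, hlm⟩ := hR.exists_gt (max l (thr l))
    obtain ⟨R', h1, h2, h3⟩ := all m (hRM hm) R hRM hR
    exact ⟨⟨(m, R'), hRM hm, h1.trans hRM, h2, h3⟩, lt_of_le_of_lt (le_max_left _ _) hlm,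
      (le_max_right _ _).trans hlm.le, hm, h1⟩
  choose next hn1 hn2 hn3 hn4 using step
  obtain ⟨l₀, hl₀⟩ := hM.nonempty
  obtain ⟨R₀, h1, h2, h3⟩ := all l₀ hl₀ M subset_rfl hM
  let x₀ : {x // P x} := ⟨(l₀, R₀), hl₀, h1, h2, h3⟩
  let x : ℕ → {x // P x} := fun i => next^[i] x₀
  have hx : ∀ i, x (i + 1) = next (x i) := fun i => Function.iterate_succ_apply' _ _ _
  let l : ℕ → ℕ := fun i => (x i).1.1
  have hl : StrictMono l := strictMono_nat_of_lt_succ fun i => by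
    simp only [l, hx]; exact hn1 _
  have hR : Antitone fun i => (x i).1.2 := antitone_nat_of_succ_le fun i => by
    simp only [hx]; exact hn4 _
  refine ⟨Set.range l, ?_, Set.infinite_range_of_injective hl.injective, ?_⟩
  · rintro _ ⟨i, rfl⟩
    exact (x i).2.1
  · rintro _ ⟨i, rfl⟩ _ ⟨j, rfl⟩ hij
    have hij' : i < j := hl.lt_iff_lt.1 hij
    refine hmono _ _ _ _ ?_ ((x j).2.2.2.2 (l i) (x i).2.1 hij ?_)
    · rintro _ ⟨⟨k, rfl⟩, hk⟩
      have hjk : j < k := hl.lt_iff_lt.1 hk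
      obtain ⟨k, rfl⟩ : ∃ k', k = k' + 1 := ⟨k - 1, by omega⟩
      have : l (k + 1) ∈ (x k).1.2 := by
        simp only [l, hx]; exact hn3 _
      exact hR (show j ≤ k by omega) this
    · refine le_trans ?_ (hl.monotone (show i + 1 ≤ j from hij'))
      simp only [l, hx]
      exact hn2 _

/-- Two uniform families, the second one of at least the rank of the first one, form a regular
pair on an infinite set. -/
theorem exists_regularPair (α : Ordinal.{0}) : ∀ (β : Ordinal.{0}) (F G : Set (Finset ℕ))
    (M N R : Set ℕ), α ≤ β → IsUniformOn α M F → IsUniformOn β N G →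
    (∀ s ∈ G, ∀ t ∈ G, s ⊆ t → s = t) → R ⊆ M → R ⊆ N → R.Infinite →
    ∃ L ⊆ R, L.Infinite ∧ RegularPair F G L := by
  induction α using WellFoundedLT.induction with
  | _ α ih =>
  intro β F G M N R hαβ hF hG hanti hRM hRN hR
  rcases eq_or_ne α 0 with rfl | hα
  · refine ⟨R, subset_rfl, hR, fun S T _ _ _ p q hp _ => ?_⟩
    rw [hF.eq_of_zero] at hp
    have : p = 0 := by simpa using hp
    omega
  have hβ : β ≠ 0 := fun h => hα (by simpa [h] using hαβ)
  obtain ⟨a, ha1, ha2, -⟩ := hF.exists_rank hα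
  obtain ⟨b, hb1, -, hb3⟩ := hG.exists_rank hβ
  -- This rules out q = 0 below: a set in `G` with a first element would contain ∅.
  have hempty : ∅ ∉ G := by
    intro h0
    obtain ⟨n, hn⟩ := hR.nonempty
    obtain ⟨s, hs⟩ := (hb1 n (hRN hn)).nonempty (tail_infinite (hR.mono hRN) n)
    exact absurd (hanti ∅ h0 _ hs.2 (Finset.empty_subset _)).symm (Finset.insert_ne_empty _ _)
  -- Since a n < α ≤ β, the ranks b m eventually reach a n; from there on the induction hypothesis
  -- covers the derived families at n and m.
  have hthr : ∀ n, ∃ k, n ∈ R → ∀ m ∈ N, k ≤ m → a n ≤ b m := by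
    intro n
    by_cases hn : n ∈ R
    · obtain ⟨k, hk⟩ := hb3 (a n) ((ha2 n (hRM hn)).trans_le hαβ)
      exact ⟨k, fun _ => hk⟩
    · exact ⟨0, fun h => absurd h hn⟩
  choose thr hthr using hthr
  obtain ⟨L, hLR, hL, hLgood⟩ := exists_diagonal hR thr
    (fun n m R' => RegularPair (derivedFamily F n) (derivedFamily G m) R')
    (fun n m R R' h h' => h'.mono h) (by
      intro n hn m hm hnm hle R' hR' hR'inf
      obtain ⟨L, h1, h2, h3⟩ := ih (a n) (ha2 n (hRM hn)) (b m) (derivedFamily F n)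
        (derivedFamily G m) (tail M n) (tail N m) (tail R' m) (hthr n hn m (hRN hm) hle)
        (ha1 n (hRM hn)) (hb1 m (hRN hm)) (by
          intro s hs t ht hst
          have := hanti _ hs.2 _ ht.2 (Finset.insert_subset_insert m hst)
          have h' := congrArg (fun u => u.erase m) this
          simpa [Finset.erase_insert (fun h => lt_irrefl _ (hs.1 m h)),
            Finset.erase_insert (fun h => lt_irrefl _ (ht.1 m h))] using h')
        (fun k hk => ⟨hRM (hR' hk.1), hnm.trans hk.2⟩) (fun k hk => ⟨hRN (hR' hk.1), hk.2⟩)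
        (tail_infinite hR'inf m)
      exact ⟨L, h1.trans fun k hk => hk.1, h2, h3⟩)
  refine ⟨L, hLR, hL, fun S T hST hS hT p q hp hq => ?_⟩
  rcases q with _ | q
  · exact absurd (by simpa using hq) hempty
  rcases p with _ | p
  · omega
  have hSm := hST.strictMono_left
  have hTm := hST.strictMono_right
  -- Deleting the first terms of S and T leaves interlaced sequences in L beyond T 0.
  have := hLgood (S 0) (hS 0) (T 0) (hT 0) (hST 0).1 (fun k => S (k + 1)) (fun k => T (k + 1))
    (fun k => hST (k + 1))
    (fun k => ⟨hS _, (hST 0).2.trans_le (hSm.monotone (by omega))⟩)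
    (fun k => ⟨hT _, hTm (by omega)⟩) p q
    (image_range_succ_mem_derivedFamily hSm hp) (image_range_succ_mem_derivedFamily hTm hq)
  omega

/-! ### Interpolation of plegma families -/

/-- A finite array whose rows carry the labels `d 0 < d 1 < ⋯`, with sufficiently large gaps
between its entries, extends to an array with rows labelled by all `j ≤ d K`. The row `i` of the
given array has an entry in column `k` if `A i k`. -/
theorem exists_interpolation {K : ℕ} (A : Fin (K + 1) → ℕ → Prop)
    (W : Fin (K + 1) → ℕ → ℕ) (d : Fin (K + 1) → ℕ) (hd : StrictMono d) (c : ℕ)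
    (hlast : ∀ k, A (Fin.last K) k)
    (h1 : ∀ i i' k, i < i' → A i k → A i' k → W i k + d i' < W i' k)
    (h2 : ∀ i i' k, A i k → A i' (k + 1) → W i k + d i' < W i' (k + 1))
    (h3 : ∀ i k, A i k → c + d i < W i k) :
    ∃ T : ℕ → ℕ → ℕ, (∀ i k, A i k → T (d i) k = W i k) ∧
      (∀ j j' k, j < j' → j' ≤ d (Fin.last K) → T j k < T j' k) ∧
      (∀ j j' k, j ≤ d (Fin.last K) → j' ≤ d (Fin.last K) → T j k < T j' (k + 1)) ∧
      ∀ j k, j ≤ d (Fin.last K) → c < T j k := by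
  -- T j k is the minimum of W i k - (d i - j) over the rows i with d i ≥ j that have an entry in
  -- column k. The last row always competes, and `h3` keeps the subtraction from truncating.
  have hT : ∀ j k, ∃ t, j ≤ d (Fin.last K) →
      (∃ i, j ≤ d i ∧ A i k ∧ t + d i = W i k + j) ∧
      ∀ i, j ≤ d i → A i k → t + d i ≤ W i k + j := by
    intro j k
    by_cases hj : j ≤ d (Fin.last K)
    · classical
      obtain ⟨i, hi, hmin⟩ := Finset.exists_min_image
        (Finset.univ.filter fun i => j ≤ d i ∧ A i k) (fun i => W i k + j - d i)
        ⟨Fin.last K, by simp [hj, hlast]⟩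
      simp only [Finset.mem_filter, Finset.mem_univ, true_and] at hi hmin
      refine ⟨W i k + j - d i, fun _ => ⟨⟨i, hi.1, hi.2, ?_⟩, fun i' hi' hA => ?_⟩⟩
      · have := h3 i k hi.2
        omega
      · have := hmin i' ⟨hi', hA⟩
        have := h3 i' k hA
        omega
    · exact ⟨0, fun h => absurd h hj⟩
  choose T hT using hT
  refine ⟨T, ?_, ?_, ?_, ?_⟩
  · intro i k hA
    obtain ⟨⟨i', hi', hA', he⟩, hle⟩ := hT (d i) k (hd.monotone (Fin.le_last i))
    have := hle i le_rfl hA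
    rcases (hd.le_iff_le.1 hi').eq_or_lt with rfl | hlt
    · omega
    · have := h1 i i' k hlt hA hA'
      omega
  · intro j j' k hjj' hj'
    -- A row attaining the minimum for j' also competes for j, with a smaller value.
    obtain ⟨⟨i, hi, hA, he⟩, -⟩ := hT j' k hj'
    have := (hT j k (by omega)).2 i (by omega) hA
    omega
  · intro j j' k hj hj'
    obtain ⟨⟨i, hi, hA, he⟩, -⟩ := hT j k hj
    obtain ⟨⟨i', hi', hA', he'⟩, -⟩ := hT j' (k + 1) hj'
    have := h2 i i' k hA hA'
    omega
  · intro j k hj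
    obtain ⟨⟨i, hi, hA, he⟩, -⟩ := hT j k hj
    have := h3 i k hA
    omega

/-! ### Enumerations of finite sets -/

theorem nthElt_image {S : ℕ → ℕ} (hS : StrictMono S) (p k : ℕ)
    (hk : k < ((Finset.range p).image S).card) :
    nthElt ((Finset.range p).image S) k hk = S k := by
  have hcard : ((Finset.range p).image S).card = p := by
    rw [Finset.card_image_of_injective _ hS.injective, Finset.card_range]
  have := Finset.orderEmbOfFin_unique (s := (Finset.range p).image S) rfl
    (f := fun i => S i) (fun i => Finset.mem_image_of_mem _
      (Finset.mem_range.2 (i.2.trans_eq hcard))) (fun i j hij => hS hij)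
  exact (congrFun this ⟨k, hk⟩).symm

theorem isPlegma_image {n : ℕ} (T : Fin n → ℕ → ℕ) (p : Fin n → ℕ) (hT : ∀ i, StrictMono (T i))
    (hp : ∀ i j, i ≤ j → p i ≤ p j) (h1 : ∀ i j k, i < j → T i k < T j k)
    (h2 : ∀ i j k, T i k < T j (k + 1)) :
    IsPlegma fun i => (Finset.range (p i)).image (T i) where
  card_le i j hij := by
    simpa [Finset.card_image_of_injective _ (hT _).injective] using hp i j hij
  lt_same i j hij k hi hj := by
    simpa [nthElt_image (hT _)] using h1 i j k hij
  lt_next i j k hi hj := by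
    simpa [nthElt_image (hT _)] using h2 i j k

/-- The increasing enumeration of `u`, continued by `M + k` from `k = |u|` on. -/
noncomputable def enumFrom (M : ℕ) (u : Finset ℕ) (k : ℕ) : ℕ :=
  if h : k < u.card then nthElt u k h else M + k

theorem enumFrom_of_lt {M : ℕ} {u : Finset ℕ} {k : ℕ} (h : k < u.card) :
    enumFrom M u k = nthElt u k h := dif_pos h

theorem enumFrom_of_le {M : ℕ} {u : Finset ℕ} {k : ℕ} (h : u.card ≤ k) :
    enumFrom M u k = M + k := dif_neg (not_lt.2 h)

theorem nthElt_mem (u : Finset ℕ) (k : ℕ) (h : k < u.card) : nthElt u k h ∈ u :=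
  Finset.orderEmbOfFin_mem _ _ _

theorem enumFrom_mem {M : ℕ} {u : Finset ℕ} {k : ℕ} (h : k < u.card) : enumFrom M u k ∈ u := by
  rw [enumFrom_of_lt h]
  exact nthElt_mem u k h

theorem exists_enumFrom_eq (M : ℕ) {u : Finset ℕ} {x : ℕ} (hx : x ∈ u) :
    ∃ k < u.card, enumFrom M u k = x := by
  have : x ∈ Set.range (u.orderEmbOfFin rfl) := by simpa using hx
  obtain ⟨⟨k, hk⟩, rfl⟩ := this
  exact ⟨k, hk, enumFrom_of_lt hk⟩

theorem enumFrom_strictMono {M : ℕ} {u : Finset ℕ} (hM : ∀ x ∈ u, x < M) :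
    StrictMono (enumFrom M u) := by
  refine strictMono_nat_of_lt_succ fun k => ?_
  rcases lt_or_ge (k + 1) u.card with h | h
  · rw [enumFrom_of_lt h, enumFrom_of_lt (by omega)]
    exact (u.orderEmbOfFin rfl).strictMono (Nat.lt_succ_self k)
  · rw [enumFrom_of_le h]
    rcases lt_or_ge k u.card with h' | h'
    · have := hM _ (enumFrom_mem (M := M) h')
      omega
    · rw [enumFrom_of_le h']
      omega

theorem enumFrom_insert_zero {M n : ℕ} {s : Finset ℕ} (hs : ∀ k ∈ s, n < k)
    (hM : ∀ x ∈ insert n s, x < M) : enumFrom M (insert n s) 0 = n := by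
  obtain ⟨k, hk, hkn⟩ := exists_enumFrom_eq M (Finset.mem_insert_self n s)
  have h0 := (enumFrom_strictMono hM).monotone (Nat.zero_le k)
  rw [hkn] at h0
  rcases Finset.mem_insert.1 (enumFrom_mem (M := M) (u := insert n s) (k := 0) (by omega))
    with h | h
  · exact h
  · have := hs _ h
    omega

theorem eq_image_enumFrom_insert {M n : ℕ} {s : Finset ℕ} (hs : ∀ k ∈ s, n < k)
    (hM : ∀ x ∈ insert n s, x < M) :
    s = (Finset.range s.card).image fun k => enumFrom M (insert n s) (k + 1) := by
  have hn : n ∉ s := fun h => lt_irrefl _ (hs n h)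
  have hcard := Finset.card_insert_of_notMem hn
  have h0 := enumFrom_insert_zero hs hM
  ext x
  simp only [Finset.mem_image, Finset.mem_range]
  constructor
  · intro hx
    obtain ⟨k, hk, rfl⟩ := exists_enumFrom_eq M (Finset.mem_insert_of_mem hx : x ∈ insert n s)
    rcases k with _ | k
    · exact absurd (h0 ▸ hx) hn
    · exact ⟨k, by omega, rfl⟩
  · rintro ⟨k, hk, rfl⟩
    refine Finset.mem_of_mem_insert_of_ne (enumFrom_mem (by omega)) fun h => ?_
    have := enumFrom_strictMono hM (Nat.zero_lt_succ k)
    rw [h, h0] at this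
    exact lt_irrefl _ this

/-! ### Barriers -/

theorem IsInitialSegment.exists_eq_image {S : ℕ → ℕ} (hS : StrictMono S) {s : Finset ℕ}
    (h : IsInitialSegment s (Set.range S)) : ∃ p, s = (Finset.range p).image S := by
  have hex : ∃ k, S k ∉ s := by
    by_contra! hall
    exact (Set.infinite_range_of_injective hS.injective).mono
      (Set.range_subset_iff.2 hall) s.finite_toSet
  classical
  refine ⟨Nat.find hex, ?_⟩
  ext x
  simp only [Finset.mem_image, Finset.mem_range]
  constructor
  · intro hx
    obtain ⟨k, rfl⟩ := h.1 hx
    refine ⟨k, ?_, rfl⟩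
    by_contra hk
    exact Nat.find_spec hex (h.2 _ ⟨_, rfl⟩ _ hx (hS.monotone (not_lt.1 hk)))
  · rintro ⟨k, hk, rfl⟩
    exact not_not.1 (Nat.find_min hex hk)

theorem IsBarrier.exists_image_mem {B : Set (Finset ℕ)} (hB : IsBarrier B) {S : ℕ → ℕ}
    (hS : StrictMono S) : ∃ p, (Finset.range p).image S ∈ B := by
  obtain ⟨s, hs, hi⟩ := hB.exists_initialSegment _
    (Set.infinite_range_of_injective hS.injective)
  obtain ⟨p, rfl⟩ := hi.exists_eq_image hS
  exact ⟨p, hs⟩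

theorem IsBarrier.eq_of_subset {B : Set (Finset ℕ)} (hB : IsBarrier B) {s t : Finset ℕ}
    (hs : s ∈ B) (ht : t ∈ B) (h : s ⊆ t) : s = t :=
  by_contra fun hne => hB.not_subset s hs t ht hne h

theorem IsBarrier.image_range_eq {B : Set (Finset ℕ)} (hB : IsBarrier B) {S : ℕ → ℕ} {p q : ℕ}
    (hp : (Finset.range p).image S ∈ B) (hq : (Finset.range q).image S ∈ B) :
    (Finset.range p).image S = (Finset.range q).image S := by
  rcases le_total p q with h | h
  · exact hB.eq_of_subset hp hq (Finset.image_subset_image (by simpa using h))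
  · exact (hB.eq_of_subset hq hp (Finset.image_subset_image (by simpa using h))).symm

/-- The family of the sets `{n} ∪ s` with `n < s` and `ψ(s) ∈ B`. -/
def succFamily (B : Set (Finset ℕ)) (ψ : ℕ → ℕ) : Set (Finset ℕ) :=
  {u | ∃ (n : ℕ) (s : Finset ℕ), (∀ k ∈ s, n < k) ∧ s.image ψ ∈ B ∧ u = insert n s}

theorem insert_inj_of_lt {n m : ℕ} {s t : Finset ℕ} (hs : ∀ k ∈ s, n < k) (ht : ∀ k ∈ t, m < k)
    (h : insert n s = insert m t) : n = m ∧ s = t := by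
  have hn : n ∉ s := fun h => lt_irrefl _ (hs n h)
  have hm : m ∉ t := fun h => lt_irrefl _ (ht m h)
  have h1 : n ∈ insert m t := h ▸ Finset.mem_insert_self n s
  have h2 : m ∈ insert n s := h ▸ Finset.mem_insert_self m t
  have hnm : n = m := by
    rcases Finset.mem_insert.1 h1 with h1 | h1
    · exact h1
    rcases Finset.mem_insert.1 h2 with h2 | h2
    · exact h2.symm
    have := hs _ h2
    have := ht _ h1
    omega
  subst hnm
  refine ⟨rfl, ?_⟩
  rw [← Finset.erase_insert hn, h, Finset.erase_insert hm]

/-- Every derived family is the pullback of `B` under ψ to a tail of ℕ, hence again ξ-uniform. An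
initial segment of M is found by removing its minimum and applying ψ to the rest. -/
theorem isUniformBarrier_succFamily {ξ : Ordinal.{0}} {B : Set (Finset ℕ)}
    (hB : IsUniformBarrier ξ B) {ψ : ℕ → ℕ} (hψ : StrictMono ψ) :
    IsUniformBarrier (ξ + 1) (succFamily B ψ) := by
  refine ⟨⟨fun M hM => ?_, ?_⟩, ?_⟩
  · classical
    have hne := hM.nonempty
    set n := sInf M with hn
    have hmin : ∀ m ∈ M, n ≤ m := fun m hm => Nat.sInf_le hm
    obtain ⟨s', hs', hi⟩ := hB.1.exists_initialSegment (ψ '' tail M n)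
      ((tail_infinite hM n).image hψ.injective.injOn)
    obtain ⟨s, hs, rfl⟩ := Finset.subset_set_image_iff.1 hi.1
    refine ⟨insert n s, ⟨n, s, fun k hk => (hs hk).2, hs', rfl⟩, ?_, ?_⟩
    · rw [Finset.coe_insert, Set.insert_subset_iff]
      exact ⟨Nat.sInf_mem hne, fun k hk => (hs hk).1⟩
    · intro a ha b hb hab
      rcases (hmin a ha).eq_or_lt with h | h
      · exact h ▸ Finset.mem_insert_self _ _
      rcases Finset.mem_insert.1 hb with rfl | hb
      · omega
      have := hi.2 (ψ a) ⟨a, ⟨ha, h⟩, rfl⟩ (ψ b) (Finset.mem_image_of_mem _ hb) (hψ.monotone hab)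
      exact Finset.mem_insert_of_mem ((hψ.injective.mem_finset_image).1 this)
  · rintro _ ⟨n, s, hs, hsB, rfl⟩ _ ⟨m, t, ht, htB, rfl⟩ hne hsub
    have hn := hsub (Finset.mem_insert_self n s)
    have hmn : m ≤ n := by
      rcases Finset.mem_insert.1 hn with h | h
      · exact h.ge
      · exact (ht n h).le
    have hst : s ⊆ t := fun k hk => by
      rcases Finset.mem_insert.1 (hsub (Finset.mem_insert_of_mem hk)) with h | h
      · have := hs k hk
        omega
      · exact h
    have heq : s = t := Finset.image_injective hψ.injective
      (hB.1.eq_of_subset hsB htB (Finset.image_subset_image hst))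
    subst heq
    rcases Finset.mem_insert.1 hn with rfl | h
    · exact hne rfl
    · exact lt_irrefl _ (hs n h)
  · refine .succ ξ _ _ fun n _ => ?_
    convert hB.2.pullback hψ (tail Set.univ n) (tail_infinite Set.infinite_univ n)
      (fun _ _ => Set.mem_univ _) using 1
    ext s
    constructor
    · rintro ⟨h1, m, t, ht, htB, he⟩
      obtain ⟨-, rfl⟩ := insert_inj_of_lt h1 ht he
      exact ⟨fun k hk => ⟨trivial, h1 k hk⟩, htB⟩
    · rintro ⟨h1, h2⟩
      exact ⟨fun k hk => (h1 hk).2, n, s, fun k hk => (h1 hk).2, h2, rfl⟩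

/-! ### Completing plegma families -/

/-- A plegma family in `succFamily B (ν ∘ Λ)` yields a plegma family in `B` indexed by all
numbers up to `φ (n K)`, in which the given sets occupy the places `φ (n i)`. -/
theorem exists_plegma_completion {B : Set (Finset ℕ)} (hB : IsBarrier B) {ν Λ φ : ℕ → ℕ}
    (hν : StrictMono ν) (hreg : RegularPair B B (Set.range ν)) (hφ : StrictMono φ)
    (hgap : ∀ v w, v < w → Λ v + φ w < Λ w) {K : ℕ}
    (n : Fin (K + 1) → ℕ) (s : Fin (K + 1) → Finset ℕ) (hs : ∀ i, ∀ k ∈ s i, n i < k)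
    (hsB : ∀ i, (s i).image (ν ∘ Λ) ∈ B) (hpl : IsPlegma fun i => insert (n i) (s i)) :
    StrictMono n ∧ ∃ t : Fin (φ (n (Fin.last K)) + 1) → B, IsPlegma (fun j => (t j : Finset ℕ)) ∧
      (∀ j, ∀ k ∈ (t j : Finset ℕ), Λ (n (Fin.last K)) < k) ∧
      ∀ i (j : Fin (φ (n (Fin.last K)) + 1)), φ (n i) = j → (t j : Finset ℕ) = (s i).image (ν ∘ Λ) := by
  -- With a common bound M, the continuations M + k lie above all genuine elements.
  obtain ⟨M, hM⟩ : ∃ M, ∀ i, ∀ x ∈ insert (n i) (s i), x < M := by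
    refine ⟨(Finset.univ.biUnion fun i => insert (n i) (s i)).sup id + 1, fun i x hx => ?_⟩
    exact Nat.lt_succ_of_le (Finset.le_sup (f := id)
      (Finset.mem_biUnion.2 ⟨i, Finset.mem_univ i, hx⟩))
  set u : Fin (K + 1) → Finset ℕ := fun i => insert (n i) (s i) with hu
  have hcard : ∀ i, (u i).card = (s i).card + 1 := fun i =>
    Finset.card_insert_of_notMem fun h => lt_irrefl _ (hs i _ h)
  have hcl := hpl.card_le
  have hVlt : ∀ i k, k < (u i).card → enumFrom M (u i) k < M := fun i k hk =>
    hM i _ (enumFrom_mem hk)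
  have hV0 : ∀ i, enumFrom M (u i) 0 = n i := fun i => enumFrom_insert_zero (hs i) (hM i)
  have hVs : ∀ i, s i = (Finset.range (s i).card).image fun k => enumFrom M (u i) (k + 1) :=
    fun i => eq_image_enumFrom_insert (hs i) (hM i)
  have hsame : ∀ i i' k, i < i' → k < (u i).card → enumFrom M (u i) k < enumFrom M (u i') k := by
    intro i i' k hii' hk
    have hk' := hk.trans_le (hcl i i' hii'.le)
    rw [enumFrom_of_lt hk, enumFrom_of_lt hk']
    exact hpl.lt_same i i' hii' k hk hk'
  have hnext : ∀ i i' k, k < (u i).card ∨ i = Fin.last K →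
      k + 1 < (u i').card ∨ i' = Fin.last K → enumFrom M (u i) k < enumFrom M (u i') (k + 1) := by
    intro i i' k hi hi'
    have hlast := hcl i' (Fin.last K) (Fin.le_last _)
    by_cases hk' : k + 1 < (u i').card
    · have hk : k < (u i).card := by
        rcases hi with hi | rfl
        · exact hi
        · omega
      rw [enumFrom_of_lt hk, enumFrom_of_lt hk']
      exact hpl.lt_next i i' k hk hk'
    · rw [enumFrom_of_le (not_lt.1 hk')]
      by_cases hk : k < (u i).card
      · have := hVlt i k hk
        omega
      · rw [enumFrom_of_le (not_lt.1 hk)]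
        omega
  have hn : StrictMono n := fun i i' hii' => by
    rw [← hV0 i, ← hV0 i']
    exact hsame i i' 0 hii' (by rw [hcard]; omega)
  refine ⟨hn, ?_⟩
  have hVn : ∀ i k, k + 1 < (u i).card ∨ i = Fin.last K →
      ∀ i', n i' < enumFrom M (u i) (k + 1) := by
    intro i k hi i'
    have h1 := hnext i' i 0 (Or.inl (by rw [hcard]; omega)) (by
      rcases hi with hi | hi
      · exact Or.inl (by omega)
      · exact Or.inr hi)
    rw [hV0] at h1
    exact h1.trans_le ((enumFrom_strictMono (hM i)).monotone (by omega))
  have hgap' : ∀ v w i, v < w → n i < w → Λ v + φ (n i) < Λ w := fun v w i h h' =>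
    lt_of_le_of_lt (Nat.add_le_add_left (hφ.monotone h'.le) _) (hgap v w h)
  -- Columns start at the second element, the first being the label. Only the last row, which is
  -- longest, is continued indefinitely; the others are prescribed just on their own elements, as
  -- equal continuations would violate strict monotonicity.
  obtain ⟨T, hT1, hT2, hT3, hT4⟩ := exists_interpolation
    (fun i k => k + 1 < (u i).card ∨ i = Fin.last K)
    (fun i k => Λ (enumFrom M (u i) (k + 1))) (fun i => φ (n i)) (hφ.comp hn)
    (Λ (n (Fin.last K))) (fun _ => Or.inr rfl)
    (fun i i' k hii' hi hi' => by
      refine hgap' _ _ _ (hsame i i' _ hii' ?_) (hVn i' k hi' i')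
      rcases hi with hi | rfl
      · exact hi
      · exact absurd hii' (Fin.le_last _).not_gt)
    (fun i i' k hi hi' => hgap' _ _ _ (hnext i i' _ hi hi') (hVn i' (k + 1) hi' i'))
    (fun i k hi => hgap' _ _ _ (hVn i k hi _) (hVn i k hi i))
  have hTm : ∀ j, j ≤ φ (n (Fin.last K)) → StrictMono (ν ∘ T j) := fun j hj =>
    hν.comp (strictMono_nat_of_lt_succ fun k => hT3 j j k hj hj)
  have hp : ∀ j : Fin (φ (n (Fin.last K)) + 1), ∃ p, (Finset.range p).image (ν ∘ T j) ∈ B :=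
    fun j => hB.exists_image_mem (hTm j (Nat.lt_succ_iff.1 j.2))
  choose p hp using hp
  refine ⟨fun j => ⟨_, hp j⟩, ?_, ?_, ?_⟩
  · refine isPlegma_image (fun j => ν ∘ T (j : ℕ)) p (fun j => hTm j (Nat.lt_succ_iff.1 j.2))
      ?_ ?_ ?_
    · intro i j hij
      rcases hij.eq_or_lt with rfl | hij
      · exact le_rfl
      have hj := Nat.lt_succ_iff.1 j.2
      have hi := Nat.lt_succ_iff.1 i.2
      exact hreg (ν ∘ T i) (ν ∘ T j) (fun k => ⟨hν (hT2 _ _ k hij hj), hν (hT3 _ _ k hj hi)⟩)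
        (fun k => ⟨_, rfl⟩) (fun k => ⟨_, rfl⟩) _ _ (hp i) (hp j)
    · exact fun i j k hij => hν (hT2 _ _ k hij (Nat.lt_succ_iff.1 j.2))
    · exact fun i j k => hν (hT3 _ _ k (Nat.lt_succ_iff.1 i.2) (Nat.lt_succ_iff.1 j.2))
  · intro j k hk
    obtain ⟨l, -, rfl⟩ := Finset.mem_image.1 hk
    exact (hT4 j l (Nat.lt_succ_iff.1 j.2)).trans_le (hν.id_le _)
  · intro i j hij
    have hsi : (s i).image (ν ∘ Λ) = (Finset.range (s i).card).image (ν ∘ T j) := by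
      conv_lhs => rw [hVs i]
      rw [Finset.image_image]
      refine Finset.image_congr fun k hk => ?_
      have hk' : k < (s i).card := by simpa using hk
      have := hT1 i k (Or.inl (by rw [hcard]; omega))
      rw [hij] at this
      simp only [Function.comp_apply, this]
    -- Row φ(n i) begins with νΛ(s i), and a sequence has only one initial segment in `B`.
    have hB' := hsB i
    rw [hsi] at hB' ⊢
    exact hB.image_range_eq (hp j) hB'

/-! ### Spreading models of asymptotic models -/

section Models

variable {X : Type*} [NormedAddCommGroup X] [NormedSpace ℝ X]
variable {E : Type*} [NormedAddCommGroup E] [NormedSpace ℝ E]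
variable {F : Type*} [NormedAddCommGroup F] [NormedSpace ℝ F]

theorem MemSP.memAM {ξ : Ordinal.{0}} {e : ℕ → E} (h : MemSP X ξ e) : MemAM X ξ e := by
  obtain ⟨B, x, hB, hx, -, he⟩ := h
  exact ⟨B, x, hB, hx, he⟩

/-- Normalization of the spreading model is not part of its definition. It follows by testing a
single unit coefficient on vectors x (m + j) and letting m tend to infinity. -/
theorem GeneratesSpreadingModel.norm_eq_one {x : ℕ → X} {e : ℕ → E}
    (h : GeneratesSpreadingModel x e) (n : ℕ) : ‖e n‖ = 1 := by
  obtain ⟨hx, -, -, ε, -, hε0, hε⟩ := h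
  have key : ∀ m, n + 1 ≤ m → |1 - ‖e n‖| ≤ ε m := by
    intro m hm
    have := hε n (fun j => m + j) (fun i j hij => Nat.add_lt_add_left hij m) (by simpa using hm)
      (Pi.single (Fin.last n) 1) (fun j => by
        rcases eq_or_ne j (Fin.last n) with rfl | hj
        · simp
        · simp [Pi.single_eq_of_ne hj])
    simp only [Pi.single_apply, ite_smul, one_smul, zero_smul, Finset.sum_ite_eq',
      Finset.mem_univ, if_true, hx] at this
    simpa using this.le
  have hle : |1 - ‖e n‖| ≤ 0 := ge_of_tendsto hε0 (eventually_atTop.2 ⟨n + 1, key⟩)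
  have := abs_nonpos_iff.1 hle
  linarith

theorem sum_extend_smul {ι κ : Type*} [Fintype ι] [Fintype κ] {g : ι → κ}
    (hg : Function.Injective g) (a : ι → ℝ) (v : κ → X) :
    ∑ j, Function.extend g a 0 j • v j = ∑ i, a i • v (g i) := by
  refine (Fintype.sum_of_injective g hg _ _ (fun j hj => ?_) fun i => ?_).symm
  · rw [Function.extend_apply' _ _ _ (by simpa using hj)]
    simp
  · rw [hg.extend_apply]

/-- A strictly monotone sequence whose jumps dominate `φ`. -/
theorem exists_gaps (φ : ℕ → ℕ) : ∃ Λ : ℕ → ℕ, StrictMono Λ ∧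
    (∀ v w, v < w → Λ v + φ w < Λ w) ∧ ∀ v, φ v + 1 < Λ v ∧ v < Λ v := by
  let Λ : ℕ → ℕ := fun v => ∑ w ∈ Finset.range (v + 1), (φ w + 2)
  have hsucc : ∀ v, Λ (v + 1) = Λ v + (φ (v + 1) + 2) := fun v => Finset.sum_range_succ _ _
  have hmono : StrictMono Λ := strictMono_nat_of_lt_succ fun v => by rw [hsucc]; omega
  have h0 : Λ 0 = φ 0 + 2 := by simp [Λ]
  refine ⟨Λ, hmono, fun v w hvw => ?_, fun v => ?_⟩
  · obtain ⟨w, rfl⟩ : ∃ w', w = w' + 1 := ⟨w - 1, by omega⟩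
    have := hmono.monotone (show v ≤ w by omega)
    rw [hsucc]
    omega
  · induction v with
    | zero => omega
    | succ v ih =>
      rw [hsucc]
      omega

theorem MemAM.memSP_of_generatesSpreadingModel {ξ : Ordinal.{0}} {f : ℕ → F} {e : ℕ → E}
    {φ : ℕ → ℕ} (hφ : StrictMono φ) (hf : MemAM X ξ f)
    (he : GeneratesSpreadingModel (fun i => f (φ i)) e) : MemSP X (ξ + 1) e := by
  have hnorm := he.norm_eq_one
  obtain ⟨B, x, hB, hx, -, -, ε, hεm, hε0, hε⟩ := hf
  obtain ⟨-, -, hbasis, δ, hδm, hδ0, hδ⟩ := he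
  obtain ⟨L, -, hL, hreg⟩ := exists_regularPair ξ ξ B B Set.univ Set.univ Set.univ le_rfl hB.2 hB.2
    (fun s hs t ht => hB.1.eq_of_subset hs ht) subset_rfl subset_rfl Set.infinite_univ
  have hν : StrictMono (Nat.nth (· ∈ L)) := Nat.nth_strictMono hL
  have hrange : Set.range (Nat.nth (· ∈ L)) ⊆ L :=
    Set.range_subset_iff.2 fun k => Nat.nth_mem_of_infinite hL k
  set ν := Nat.nth (· ∈ L)
  obtain ⟨Λ, hΛ, hgap, hΛφ⟩ := exists_gaps φ
  have hC : ∀ u : succFamily B (ν ∘ Λ), ∃ (n : ℕ) (s : Finset ℕ),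
    (∀ k ∈ s, n < k) ∧ s.image (ν ∘ Λ) ∈ B ∧ (u : Finset ℕ) = insert n s := fun u => u.2
  choose n s hs hsB hu using hC
  refine ⟨succFamily B (ν ∘ Λ), fun _ u => x (φ (n u)) ⟨_, hsB u⟩,
    isUniformBarrier_succFamily hB (hν.comp hΛ), fun _ _ => hx _ _, fun _ _ _ => rfl,
    hnorm, hbasis, fun m => ε m + δ m, fun i j hij => add_le_add (hεm hij) (hδm hij),
    by simpa using hε0.add hδ0, ?_⟩
  intro K m hKm u hpl hmin a ha
  -- The empty sum still needs ε m + δ m > 0: the asymptotic model gives ε m > 0, and δ decreases to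
  -- 0.
  rcases K with _ | K
  · have h1 := hε 0 m hKm Fin.elim0 ⟨fun i => i.elim0, fun i => i.elim0, fun i => i.elim0⟩
      (fun i => i.elim0) Fin.elim0 (fun i => i.elim0)
    have h2 := hδm.le_of_tendsto hδ0 m
    simp only [Finset.univ_eq_empty, Finset.sum_empty, norm_zero, sub_self, abs_zero] at h1 ⊢
    linarith
  obtain ⟨hn, t, htpl, htmin, ht⟩ := exists_plegma_completion hB.1 hν (hreg.mono hrange) hφ hgap
    (fun i => n (u i)) (fun i => s (u i)) (fun i => hs _) (fun i => hsB _) (by simpa [← hu] using hpl)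
  have hmn : ∀ i, m < n (u i) := fun i => hmin i _ (by rw [hu]; exact Finset.mem_insert_self _ _)
  let g : Fin (K + 1) → Fin (φ (n (u (Fin.last K))) + 1) := fun i =>
    ⟨φ (n (u i)), Nat.lt_succ_iff.2 (hφ.monotone (hn.monotone (Fin.le_last i)))⟩
  have hg : Function.Injective g := fun i j hij =>
    hn.injective (hφ.injective (congrArg Fin.val hij))
  -- The threshold is Λ(n_K): it exceeds the length φ(n_K) + 1 of the completed family and lies
  -- below all its elements.
  have h1 := hε _ _ (hΛφ _).1 t htpl htmin (Function.extend g a 0) (fun j => by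
    by_cases hj : ∃ i, g i = j
    · obtain ⟨i, rfl⟩ := hj
      rw [hg.extend_apply]
      exact ha i
    · rw [Function.extend_apply' _ _ _ hj]
      simp)
  rw [sum_extend_smul hg a (fun j => f j), sum_extend_smul hg a (fun j => x j (t j))] at h1
  have h2 := hδ K (fun i => n (u i)) hn (hKm.le.trans (hmn 0).le) a ha
  have hxt : ∀ i, x (g i) (t (g i)) = x (φ (n (u i))) ⟨_, hsB (u i)⟩ := fun i => by
    rw [show t (g i) = ⟨_, hsB (u i)⟩ from Subtype.ext (ht i (g i) rfl)]
  simp only [hxt] at h1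
  have h3 : ε (Λ (n (u (Fin.last K)))) ≤ ε m :=
    hεm ((hmn _).le.trans (hΛφ _).2.le)
  have h4 : δ (n (u 0)) ≤ δ m := hδm (hmn 0).le
  calc _ ≤ |‖∑ i, a i • f (φ (n (u i)))‖ - ‖∑ i, a i • e i‖| +
        |‖∑ i, a i • f (g i)‖ - ‖∑ i, a i • x (φ (n (u i))) ⟨_, hsB (u i)⟩‖| := by
        rw [abs_sub_comm ‖∑ i, a i • f (φ (n (u i)))‖]
        exact abs_sub_le _ _ _
    _ < ε m + δ m := by linarith

end Models

end PlegmaModels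

theorem mainTheorem4
    (ξ : Ordinal.{0}) (hξ0 : ξ ≠ 0) (hξ : ξ < Ordinal.omega 1)
    (X : Type*) [NormedAddCommGroup X] [NormedSpace ℝ X] [CompleteSpace X] :
    (∀ (E : Type*) [NormedAddCommGroup E] [NormedSpace ℝ E] [CompleteSpace E] (e : ℕ → E),
      PlegmaModels.MemSP X ξ e → PlegmaModels.MemAM X ξ e) ∧
    (∀ (F : Type*) [NormedAddCommGroup F] [NormedSpace ℝ F] [CompleteSpace F] (f : ℕ → F)
      (E : Type*) [NormedAddCommGroup E] [NormedSpace ℝ E] [CompleteSpace E] (e : ℕ → E)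
      (φ : ℕ → ℕ), StrictMono φ → PlegmaModels.MemAM X ξ f →
      PlegmaModels.GeneratesSpreadingModel (fun i => f (φ i)) e →
      PlegmaModels.MemSP X (ξ + 1) e) := by
  exact ⟨fun E _ _ _ e h => h.memAM,
    fun F _ _ _ f E _ _ _ e φ hφ hf he => hf.memSP_of_generatesSpreadingModel hφ he⟩
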